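/- Let $\mathcal P$ be a smooth manifold. Multivector fields are regarded as alternating multilinear forms on covectors; the wedge product is the sum over shuffles (without factorial factors), and $\iota_\beta$ denotes right contraction, $(\iota_\beta X)(\alpha_1,\dots,\alpha_{k})=X(\alpha_1,\dots,\alpha_{k},\beta)$ for a $(k+1)$-vector field $X$. A $3$-vector field is Nambu–Poisson if its bracket $\{F_1,F_2,F_3\}=\eta(dF_1,dF_2,dF_3)$ satisfies the fundamental identity $\{F_1,F_2,\{G_1,G_2,G_3\}\}=\{\{F_1,F_2,G_1\},G_2,G_3\}+\{G_1,\{F_1,F_2,G_2\},G_3\}+\{G_1,G_2,\{F_1,F_2,G_3\}\}$. A $4$-vector field is generalized Poisson if its bracket $\{F_1,\dots,F_4\}$ satisfies the generalized Jacobi identity $\sum_{\tau\in S_7}\operatorname{sgn}(\tau)\{F_{\tau(1)},F_{\tau(2)},F_{\tau(3)},\{F_{\tau(4)},\dots,F_{\tau(7)}\}\}=0$. A locally conformally $k$-Nambu–Poisson (respectively $k$-generalized Poisson) manifold $(\mathcal P,U_\alpha,\eta^{[k]}_\alpha,\sigma_\alpha)$ consists of an open cover $\{U_\alpha\}$ of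 $\mathcal P$, smooth functions $\sigma_\alpha$ on $U_\alpha$ and Nambu–Poisson (respectively generalized Poisson) $k$-vector fields $\eta^{[k]}_\alpha$ on $U_\alpha$ such that, on all overlaps, $d\sigma_\alpha=d\sigma_\beta$ and $e^{-(k-1)\sigma_\alpha}\eta^{[k]}_\alpha=e^{-(k-1)\sigma_\beta}\eta^{[k]}_\beta$. Its Lee form is the one-form $\theta$ with $\theta|_{U_\alpha}=d\sigma_\alpha$, and its global $k$-vector field is the $\eta^{[k]}$ with $\eta^{[k]}|_{U_\alpha}=e^{-(k-1)\sigma_\alpha}\eta^{[k]}_\alpha$; the structure is then also denoted by $(\mathcal P,\eta^{[k]},\theta)$. A bivector field $\Lambda$ and a vector field $Z$ form a Jacobi pair if $\{F,G\}=\Lambda(dF,dG)+F\,Z(G)-G\,Z(F)$ satisfies the Jacobi identity on $C^\infty(\mathcal P)$; two Jacobi pairs are compatible if their sum is a Jacobi pair. Let $(\mathcal P,U_\alpha,\eta^{[3]}_\alpha,\sigma_\alpha)$ be a locally conformally $3$-Nambu–Poisson manifold with global $3$-vector field $\eta^{[3]}$ and Lee form $\theta$, put $\mathcal E^{[2]}=-\iota_\theta\eta^{[3]}$,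 let $H^1,H^2\in C^\infty(\mathcal P)$, and define $$\Lambda^1=-\iota_{dH^1}\eta^{[3]}-H^1\mathcal E^{[2]},\quad Z^1=-\iota_{dH^1}\mathcal E^{[2]},\quad \Lambda^2=\iota_{dH^2}\eta^{[3]}+H^2\mathcal E^{[2]},\quad Z^2=\iota_{dH^2}\mathcal E^{[2]},$$ $$\eta^{[4]}=\Lambda^1\wedge\Lambda^2,\qquad \mathcal E^{[3]}=Z^1\wedge\Lambda^2+Z^2\wedge\Lambda^1 .$$ Then: (i) $(\Lambda^1,Z^1)$ and $(\Lambda^2,Z^2)$ are compatible Jacobi pairs; (ii) $\mathcal E^{[3]}=\iota_\theta\eta^{[4]}$; (iii) $(\mathcal P,U_\alpha,e^{3\sigma_\alpha}\eta^{[4]}|_{U_\alpha},\sigma_\alpha)$ is a locally conformally $4$-generalized Poisson manifold with global $4$-vector field $\eta^{[4]}$ and Lee form $\theta$; that is, the triple $(\mathcal P,\eta^{[4]},\theta)$ is a locally conformally $4$-generalized Poisson manifold. -/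

import Mathlib

open scoped Manifold ContDiff

universe u

noncomputable section

namespace LCNambu

/-- The cotangent space at `x` of an `n`-dimensional manifold `M`. -/
abbrev Cotangent (n : ℕ) {M : Type*} [TopologicalSpace M]
    [ChartedSpace (EuclideanSpace ℝ (Fin n)) M] (x : M) : Type :=
  TangentSpace (𝓡 n) x →L[ℝ] ℝ

/-- `k`-vectors at `x`: the elements of `⋀ᵏ TₓM`, seen as alternating `k`-linear forms on the
cotangent space (`X₁ ∧ ⋯ ∧ X_k` is `(α₁, …, α_k) ↦ det (αᵢ(X_j))`). -/
abbrev Multivector (n : ℕ) {M : Type*} [TopologicalSpace M]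
    [ChartedSpace (EuclideanSpace ℝ (Fin n)) M] (k : ℕ) (x : M) : Type :=
  (Cotangent n x) [⋀^Fin k]→ₗ[ℝ] ℝ

/-- (Not necessarily smooth) `k`-vector fields. -/
abbrev MultivectorField (n : ℕ) (M : Type*) [TopologicalSpace M]
    [ChartedSpace (EuclideanSpace ℝ (Fin n)) M] (k : ℕ) : Type _ :=
  (x : M) → Multivector n k x

/-- (Not necessarily smooth) one-forms. -/
abbrev OneForm (n : ℕ) (M : Type*) [TopologicalSpace M]
    [ChartedSpace (EuclideanSpace ℝ (Fin n)) M] : Type _ :=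
  (x : M) → Cotangent n x

section PointwiseAlgebra

variable {V : Type*} [AddCommGroup V] [Module ℝ V]

/-- The exterior product of alternating forms, normalised as the sum over shuffles. -/
def wedge {k l : ℕ} (a : V [⋀^Fin k]→ₗ[ℝ] ℝ) (b : V [⋀^Fin l]→ₗ[ℝ] ℝ) :
    V [⋀^Fin (k + l)]→ₗ[ℝ] ℝ :=
  ((LinearMap.mul' ℝ ℝ).compAlternatingMap (a.domCoprod b)).domDomCongr finSumFinEquiv

/-- Right contraction with a covector `β`: it is inserted in the last slot. -/
def rightContr {k : ℕ} (β : V) (a : V [⋀^Fin (k + 1)]→ₗ[ℝ] ℝ) : V [⋀^Fin k]→ₗ[ℝ] ℝ where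
  toFun v := a (Fin.snoc (α := fun _ => V) v β)
  map_update_add' := by
    intro dec m i x y
    have : dec = instDecidableEqFin k := Subsingleton.elim _ _
    subst this
    simp only [Fin.snoc_update]
    exact a.map_update_add _ _ _ _
  map_update_smul' := by
    intro dec m i c x
    have : dec = instDecidableEqFin k := Subsingleton.elim _ _
    subst this
    simp only [Fin.snoc_update]
    exact a.map_update_smul _ _ _ _
  map_eq_zero_of_eq' := by
    intro v i j hv hij
    refine a.map_eq_zero_of_eq _ (i := i.castSucc) (j := j.castSucc) ?_ ?_
    · simpa using hv
    · simpa using hij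

end PointwiseAlgebra

variable {n : ℕ} {M : Type*} [TopologicalSpace M] [ChartedSpace (EuclideanSpace ℝ (Fin n)) M]

/-- `F` is a smooth function on the open set `U` (its values off `U` are irrelevant). -/
def SmoothFunOn (n : ℕ) {M : Type*} [TopologicalSpace M]
    [ChartedSpace (EuclideanSpace ℝ (Fin n)) M] (F : M → ℝ) (U : Set M) : Prop :=
  ContMDiffOn (𝓡 n) 𝓘(ℝ, ℝ) ∞ F U

/-- The differential of a function, as a one-form. -/
def d (n : ℕ) {M : Type*} [TopologicalSpace M]
    [ChartedSpace (EuclideanSpace ℝ (Fin n)) M] (F : M → ℝ) : OneForm n M :=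
  fun x => mfderiv (𝓡 n) 𝓘(ℝ, ℝ) F x

/-- The exterior product of multivector fields. -/
def wedgeField {k l : ℕ} (η : MultivectorField n M k) (ζ : MultivectorField n M l) :
    MultivectorField n M (k + l) :=
  fun x => wedge (η x) (ζ x)

/-- Right contraction `ι_β η` of a multivector field with a one-form:
`(ι_β η)(α₁, …, α_k) = η(α₁, …, α_k, β)`. -/
def contr {k : ℕ} (β : OneForm n M) (η : MultivectorField n M (k + 1)) :
    MultivectorField n M k :=
  fun x => rightContr (β x) (η x)

/-- The bracket `{F₁, …, F_k} = η(dF₁, …, dF_k)` of a `k`-vector field. -/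
def bracket {k : ℕ} (η : MultivectorField n M k) (F : Fin k → M → ℝ) : M → ℝ :=
  fun x => η x (fun i => d n (F i) x)

/-- Smoothness of a multivector field on an open set. -/
def IsSmoothOn {k : ℕ} (η : MultivectorField n M k) (U : Set M) : Prop :=
  ∀ F : Fin k → M → ℝ, (∀ i, SmoothFunOn n (F i) U) → SmoothFunOn n (bracket η F) U

/-- `η` is a Nambu–Poisson `(k+1)`-vector field on the open set `U`: it is smooth and its bracket
on `C^∞(U)` satisfies the fundamental identity
`{F₁, …, F_k, {G₀, …, G_k}} = ∑ᵢ {G₀, …, {F₁, …, F_k, Gᵢ}, …, G_k}`.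
(Multilinearity, skew-symmetry and the Leibniz identity hold for the bracket of any
multivector field.) -/
structure IsNambuPoissonOn {k : ℕ} (η : MultivectorField n M (k + 1)) (U : Set M) : Prop where
  smooth : IsSmoothOn η U
  fundamental : ∀ (F : Fin k → M → ℝ) (G : Fin (k + 1) → M → ℝ),
    (∀ i, SmoothFunOn n (F i) U) → (∀ i, SmoothFunOn n (G i) U) →
    ∀ x ∈ U,
      bracket η (Fin.snoc (α := fun _ => M → ℝ) F (bracket η G)) x =
        ∑ i, bracket η
          (Function.update G i (bracket η (Fin.snoc (α := fun _ => M → ℝ) F (G i)))) x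

/-- `η` is a generalized Poisson `(q+1)`-vector field on the open set `U`: its order `q+1` is even,
it is smooth, and its bracket on `C^∞(U)` satisfies the generalized Jacobi identity, i.e. the
skew-symmetrization over all permutations of `F₁, …, F_{2q+1}` of
`{F₁, …, F_q, {F_{q+1}, …, F_{2q+1}}}` vanishes. -/
structure IsGenPoissonOn {q : ℕ} (η : MultivectorField n M (q + 1)) (U : Set M) : Prop where
  even_order : Even (q + 1)
  smooth : IsSmoothOn η U
  jacobi : ∀ F : Fin (q + (q + 1)) → M → ℝ, (∀ i, SmoothFunOn n (F i) U) →
    ∀ x ∈ U,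
      ∑ τ : Equiv.Perm (Fin (q + (q + 1))), ((Equiv.Perm.sign τ : ℤ) : ℝ) *
        bracket η (Fin.snoc (α := fun _ => M → ℝ)
          (fun i : Fin q => F (τ (Fin.castAdd (q + 1) i)))
          (bracket η (fun j : Fin (q + 1) => F (τ (Fin.natAdd q j))))) x = 0

/-- An open cover `U_a` of `M` with smooth local functions `σ_a` and local `(k+1)`-vector fields
`η_a` on `U_a` such that, on all overlaps, `dσ_a = dσ_b` and
`exp(-k σ_a) η_a = exp(-k σ_b) η_b`. -/
structure IsConformalFamily {ι : Type*} {k : ℕ} (U : ι → Set M) (σ : ι → M → ℝ)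
    (ηloc : ι → MultivectorField n M (k + 1)) : Prop where
  isOpen : ∀ a, IsOpen (U a)
  cover : ∀ x, ∃ a, x ∈ U a
  smooth : ∀ a, SmoothFunOn n (σ a) (U a)
  d_agree : ∀ a b, ∀ x ∈ U a ∩ U b, d n (σ a) x = d n (σ b) x
  conformal : ∀ a b, ∀ x ∈ U a ∩ U b,
    Real.exp (-((k : ℝ) * σ a x)) • ηloc a x = Real.exp (-((k : ℝ) * σ b x)) • ηloc b x

/-- Locally conformally `(k+1)`-Nambu–Poisson manifold `(M, U_a, η_a, σ_a)`. -/
structure IsLCNambuPoisson {ι : Type*} {k : ℕ} (U : ι → Set M) (σ : ι → M → ℝ)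
    (ηloc : ι → MultivectorField n M (k + 1)) : Prop extends IsConformalFamily U σ ηloc where
  nambuPoisson : ∀ a, IsNambuPoissonOn (ηloc a) (U a)

/-- Locally conformally `(q+1)`-generalized Poisson manifold `(M, U_a, η_a, σ_a)`. -/
structure IsLCGenPoisson {ι : Type*} {q : ℕ} (U : ι → Set M) (σ : ι → M → ℝ)
    (ηloc : ι → MultivectorField n M (q + 1)) : Prop extends IsConformalFamily U σ ηloc where
  genPoisson : ∀ a, IsGenPoissonOn (ηloc a) (U a)

/-- `θ` is the Lee form: the global one-form with `θ = dσ_a` on `U_a`. -/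
def IsLeeForm {ι : Type*} (U : ι → Set M) (σ : ι → M → ℝ) (θ : OneForm n M) : Prop :=
  ∀ a, ∀ x ∈ U a, θ x = d n (σ a) x

/-- `η` is the global multivector field with `η = exp(-k σ_a) η_a` on `U_a`. -/
def IsGluing {ι : Type*} {k : ℕ} (U : ι → Set M) (σ : ι → M → ℝ)
    (ηloc : ι → MultivectorField n M (k + 1)) (η : MultivectorField n M (k + 1)) : Prop :=
  ∀ a, ∀ x ∈ U a, η x = Real.exp (-((k : ℝ) * σ a x)) • ηloc a x

/-- The Lee form of a conformal family exists and is unique. -/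
theorem IsConformalFamily.existsUnique_leeForm {ι : Type*} {k : ℕ} {U : ι → Set M}
    {σ : ι → M → ℝ} {ηloc : ι → MultivectorField n M (k + 1)}
    (h : IsConformalFamily U σ ηloc) : ∃! θ : OneForm n M, IsLeeForm U σ θ := by
  choose c hc using h.cover
  refine ⟨fun x => d n (σ (c x)) x, fun a x hx => h.d_agree _ _ x ⟨hc x, hx⟩, ?_⟩
  intro θ hθ
  funext x
  exact hθ (c x) x (hc x)

/-- The glued multivector field of a conformal family exists and is unique. -/
theorem IsConformalFamily.existsUnique_gluing {ι : Type*} {k : ℕ} {U : ι → Set M}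
    {σ : ι → M → ℝ} {ηloc : ι → MultivectorField n M (k + 1)}
    (h : IsConformalFamily U σ ηloc) :
    ∃! η : MultivectorField n M (k + 1), IsGluing U σ ηloc η := by
  choose c hc using h.cover
  refine ⟨fun x => Real.exp (-((k : ℝ) * σ (c x) x)) • ηloc (c x) x,
    fun a x hx => h.conformal _ _ x ⟨hc x, hx⟩, ?_⟩
  intro η hη
  funext x
  exact hη (c x) x (hc x)

/-- The triple `(M, η, θ)` is a locally conformally `(q+1)`-generalized Poisson manifold: `θ` is
the Lee form and `η` the glued multivector field of such a structure on some open cover. -/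
def IsLCGenPoissonTriple {n : ℕ} {M : Type u} [TopologicalSpace M]
    [ChartedSpace (EuclideanSpace ℝ (Fin n)) M] {q : ℕ} (η : MultivectorField n M (q + 1))
    (θ : OneForm n M) : Prop :=
  ∃ (ι : Type u) (U : ι → Set M) (σ : ι → M → ℝ) (ηloc : ι → MultivectorField n M (q + 1)),
    IsLCGenPoisson U σ ηloc ∧ IsLeeForm U σ θ ∧ IsGluing U σ ηloc η

/-- The bracket `{F, G} = Λ(dF, dG) + F Z(G) - G Z(F)` of a bivector field and a vector field. -/
def jacobiBracket (Λ : MultivectorField n M 2) (Z : MultivectorField n M 1) (F G : M → ℝ) :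
    M → ℝ :=
  fun x => Λ x ![d n F x, d n G x] + F x * Z x ![d n G x] - G x * Z x ![d n F x]

/-- `(Λ, Z)` is a Jacobi pair: `Λ`, `Z` are smooth and `jacobiBracket Λ Z` satisfies the Jacobi
identity on `C^∞(M)`. (Skew-symmetry and the weak Leibniz rule are automatic.) -/
structure IsJacobiPair (Λ : MultivectorField n M 2) (Z : MultivectorField n M 1) : Prop where
  smooth_bivector : IsSmoothOn Λ Set.univ
  smooth_vector : IsSmoothOn Z Set.univ
  jacobi : ∀ F₁ F₂ F₃ : M → ℝ, SmoothFunOn n F₁ Set.univ → SmoothFunOn n F₂ Set.univ →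
    SmoothFunOn n F₃ Set.univ → ∀ x,
      jacobiBracket Λ Z (jacobiBracket Λ Z F₁ F₂) F₃ x +
        jacobiBracket Λ Z (jacobiBracket Λ Z F₂ F₃) F₁ x +
        jacobiBracket Λ Z (jacobiBracket Λ Z F₃ F₁) F₂ x = 0

/-- Two Jacobi pairs are compatible if their sum is a Jacobi pair. -/
structure AreCompatibleJacobiPairs (Λ₁ : MultivectorField n M 2) (Z₁ : MultivectorField n M 1)
    (Λ₂ : MultivectorField n M 2) (Z₂ : MultivectorField n M 1) : Prop where
  first : IsJacobiPair Λ₁ Z₁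
  second : IsJacobiPair Λ₂ Z₂
  sum : IsJacobiPair (fun x => Λ₁ x + Λ₂ x) (fun x => Z₁ x + Z₂ x)

/-- `𝓔 = -ι_θ η`. -/
def assocE (η : MultivectorField n M 3) (θ : OneForm n M) : MultivectorField n M 2 :=
  fun x => -contr θ η x

/-- `Λ¹ = -ι_{dH} η - H 𝓔`. -/
def Lam1 (η : MultivectorField n M 3) (θ : OneForm n M) (H : M → ℝ) : MultivectorField n M 2 :=
  fun x => -contr (d n H) η x - H x • assocE η θ x

/-- `Z¹ = -ι_{dH} 𝓔`. -/
def Zed1 (η : MultivectorField n M 3) (θ : OneForm n M) (H : M → ℝ) : MultivectorField n M 1 :=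
  fun x => -contr (d n H) (assocE η θ) x

/-- `Λ² = ι_{dH} η + H 𝓔`. -/
def Lam2 (η : MultivectorField n M 3) (θ : OneForm n M) (H : M → ℝ) : MultivectorField n M 2 :=
  fun x => contr (d n H) η x + H x • assocE η θ x

/-- `Z² = ι_{dH} 𝓔`. -/
def Zed2 (η : MultivectorField n M 3) (θ : OneForm n M) (H : M → ℝ) : MultivectorField n M 1 :=
  contr (d n H) (assocE η θ)

/-- `η⁴ = Λ¹ ∧ Λ²`. -/
def eta4 (η : MultivectorField n M 3) (θ : OneForm n M) (H₁ H₂ : M → ℝ) :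
    MultivectorField n M 4 :=
  wedgeField (Lam1 η θ H₁) (Lam2 η θ H₂)

/-- `𝓔³ = Z¹ ∧ Λ² + Z² ∧ Λ¹`. -/
def E3 (η : MultivectorField n M 3) (θ : OneForm n M) (H₁ H₂ : M → ℝ) :
    MultivectorField n M 3 :=
  fun x => (wedgeField (Zed1 η θ H₁) (Lam2 η θ H₂) : MultivectorField n M 3) x +
    (wedgeField (Zed2 η θ H₂) (Lam1 η θ H₁) : MultivectorField n M 3) x

end LCNambu

end

/-!
On each `U a` the whole situation is conjugate to a Nambu–Poisson manifold without Lee form. Write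
`N = ηloc a`, `s = σ a`, and `f = exp(-s) F` for the rescaling of a function `F`. Then
`df = exp(-s) (dF - F θ)` and `η = exp(-2s) N`, and these two facts give
`{F, G} = exp(s) N(df, dg, dh)` for the Jacobi bracket of the pair `(Λ², Z²)` defined by `H`
(`IsConformalFrame.jacobiBracket_eq`). The bracket `(f, g) ↦ N(df, dg, dh)` satisfies the Jacobi
identity, because of the fundamental identity of `N` (`IsNambuPoissonOn.jacobi`); hence so does
`{F, G}`. The pair `(Λ¹, Z¹)` is the pair `(Λ², Z²)` of `-H`, and the pairs are linear in `H`, so the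
same statement for `-H₁`, `H₂` and `H₂ - H₁` gives the two Jacobi pairs and their compatibility.

The formula for `𝓔³` is pointwise algebra: `ι_θ` is a derivation on products of bivectors
(`rightContr_wedge_two_two`) and `ι_θ Λⁱ = Zⁱ`.

For the `4`-vector field, a product `f g` is inserted as first argument into the fundamental
identity. The terms that contain derivatives of brackets cancel, and what remains are the Plücker
relations `ι_{df} N ∧ ι_{dg} N = 0` (`IsNambuPoissonOn.pluecker`), the algebraic reason why
Nambu–Poisson tensors of order at least three are decomposable. Up to functions, `Λ¹` and `Λ²` are
contractions of `N` with `dh₁` and `dh₂`. Therefore the bracket of `η⁴ = Λ¹ ∧ Λ²` vanishes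
identically (`IsConformalFrame.eta4_bracket_eq_zero`), whatever the conformal factor, and the
generalized Jacobi identity of `exp(3s) η⁴` follows.
-/

namespace LCNambu

/-! ### Exterior products and contractions of alternating forms of low degree -/

section Alternating
variable {V : Type*} [AddCommGroup V] [Module ℝ V]

/-- The shuffle product as a sum over all permutations. -/
theorem wedge_apply_sum {k l : ℕ} (a : V [⋀^Fin k]→ₗ[ℝ] ℝ) (b : V [⋀^Fin l]→ₗ[ℝ] ℝ)
    (v : Fin (k + l) → V) :
    ((k.factorial * l.factorial : ℕ) : ℝ) * wedge a b v =
      ∑ τ : Equiv.Perm (Fin (k + l)), ((Equiv.Perm.sign τ : ℤ) : ℝ) *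
        (a (fun i => v (τ (Fin.castAdd l i))) * b (fun j => v (τ (Fin.natAdd k j)))) := by
  have h := congrArg (fun m => LinearMap.mul' ℝ ℝ (m (v ∘ finSumFinEquiv)))
    (MultilinearMap.domCoprod_alternization_eq a b)
  simp only [Fintype.card_fin, AlternatingMap.smul_apply, map_nsmul,
    MultilinearMap.alternatization_apply, map_sum] at h
  rw [← Equiv.sum_comp (finSumFinEquiv.permCongr)]
  rw [nsmul_eq_mul] at h
  refine h.symm.trans (Finset.sum_congr rfl fun τ _ => ?_)
  rw [Units.smul_def, map_zsmul, zsmul_eq_mul, Equiv.Perm.sign_permCongr]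
  simp [MultilinearMap.domCoprod_apply, Function.comp_def]

theorem alt_two_swap (a : V [⋀^Fin 2]→ₗ[ℝ] ℝ) (x y : V) : a ![y, x] = -a ![x, y] := by
  have := a.map_swap ![x, y] (i := 0) (j := 1) (by decide)
  rw [← this]; congr 1; ext i; fin_cases i <;> rfl

theorem wedge_one_two (a : V [⋀^Fin 1]→ₗ[ℝ] ℝ) (b : V [⋀^Fin 2]→ₗ[ℝ] ℝ) (v : Fin 3 → V) :
    wedge a b v = a ![v 0] * b ![v 1, v 2] - a ![v 1] * b ![v 0, v 2]
      + a ![v 2] * b ![v 0, v 1] := by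
  have h := wedge_apply_sum a b v
  have e1 : ∀ f : Fin 1 → V, f = ![f 0] := fun f => by ext i; fin_cases i; rfl
  have e2 : ∀ f : Fin 2 → V, f = ![f 0, f 1] := fun f => by ext i; fin_cases i <;> rfl
  -- write the entries as `Fin.succ`s, on which `decomposeFin` computes
  have n0 : Fin.castAdd 2 (0 : Fin 1) = 0 := rfl
  have n1 : Fin.natAdd 1 (0 : Fin 2) = Fin.succ 0 := rfl
  have n2 : Fin.natAdd 1 (1 : Fin 2) = Fin.succ (Fin.succ 0) := rfl
  simp_rw [e1 (fun i : Fin 1 => v _), e2 (fun i : Fin 2 => v _), n0, n1, n2] at h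
  simp only [Nat.reduceAdd, Finset.univ_perm_fin_succ, ← Finset.univ_product_univ,
    Finset.sum_map, Finset.sum_product, Fin.sum_univ_succ, Equiv.coe_toEmbedding,
    Equiv.Perm.decomposeFin_symm_apply_succ, Equiv.Perm.decomposeFin_symm_apply_zero,
    Equiv.Perm.decomposeFin.symm_sign, Equiv.swap_apply_def] at h
  simp at h
  have s := fun i j => alt_two_swap b (v i) (v j)
  linarith [h, congrArg (a ![v 0] * ·) (s 1 2),
    congrArg (a ![v 1] * ·) (s 0 2), congrArg (a ![v 2] * ·) (s 0 1)]

theorem wedge_two_two (a : V [⋀^Fin 2]→ₗ[ℝ] ℝ) (b : V [⋀^Fin 2]→ₗ[ℝ] ℝ) (v : Fin 4 → V) :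
    wedge a b v = a ![v 0, v 1] * b ![v 2, v 3] - a ![v 0, v 2] * b ![v 1, v 3]
      + a ![v 0, v 3] * b ![v 1, v 2] + a ![v 1, v 2] * b ![v 0, v 3]
      - a ![v 1, v 3] * b ![v 0, v 2] + a ![v 2, v 3] * b ![v 0, v 1] := by
  have h := wedge_apply_sum a b v
  have e2 : ∀ f : Fin 2 → V, f = ![f 0, f 1] := fun f => by ext i; fin_cases i <;> rfl
  -- write the entries as `Fin.succ`s, on which `decomposeFin` computes
  have n0 : Fin.castAdd 2 (0 : Fin 2) = 0 := rfl
  have n1 : Fin.castAdd 2 (1 : Fin 2) = Fin.succ 0 := rfl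
  have n2 : Fin.natAdd 2 (0 : Fin 2) = Fin.succ (Fin.succ 0) := rfl
  have n3 : Fin.natAdd 2 (1 : Fin 2) = Fin.succ (Fin.succ (Fin.succ 0)) := rfl
  simp_rw [e2 (fun i : Fin 2 => v _), n0, n1, n2, n3] at h
  simp only [Nat.reduceAdd, Finset.univ_perm_fin_succ, ← Finset.univ_product_univ,
    Finset.sum_map, Finset.sum_product, Fin.sum_univ_succ, Equiv.coe_toEmbedding,
    Equiv.Perm.decomposeFin_symm_apply_succ, Equiv.Perm.decomposeFin_symm_apply_zero,
    Equiv.Perm.decomposeFin.symm_sign, Equiv.swap_apply_def] at h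
  simp at h
  have s := fun i j => alt_two_swap b (v i) (v j)
  have t := fun i j => alt_two_swap a (v i) (v j)
  rw [s 0 1, s 0 2, s 0 3, s 1 2, s 1 3, s 2 3, t 0 1, t 0 2, t 0 3, t 1 2, t 1 3, t 2 3] at h
  linarith

theorem alt_three_swap_left (a : V [⋀^Fin 3]→ₗ[ℝ] ℝ) (x y z : V) :
    a ![y, x, z] = -a ![x, y, z] := by
  rw [← a.map_swap ![x, y, z] (i := 0) (j := 1) (by decide)]
  congr 1; ext i; fin_cases i <;> rfl

theorem alt_three_swap_right (a : V [⋀^Fin 3]→ₗ[ℝ] ℝ) (x y z : V) :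
    a ![x, z, y] = -a ![x, y, z] := by
  rw [← a.map_swap ![x, y, z] (i := 1) (j := 2) (by decide)]
  congr 1; ext i; fin_cases i <;> rfl

theorem alt_three_add_left (a : V [⋀^Fin 3]→ₗ[ℝ] ℝ) (x x' y z : V) :
    a ![x + x', y, z] = a ![x, y, z] + a ![x', y, z] :=
  a.toMultilinearMap.cons_add ![y, z] x x'

theorem alt_three_smul_left (a : V [⋀^Fin 3]→ₗ[ℝ] ℝ) (c : ℝ) (x y z : V) :
    a ![c • x, y, z] = c * a ![x, y, z] :=
  a.toMultilinearMap.cons_smul ![y, z] c x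

theorem alt_three_add_mid (a : V [⋀^Fin 3]→ₗ[ℝ] ℝ) (x y y' z : V) :
    a ![x, y + y', z] = a ![x, y, z] + a ![x, y', z] := by
  rw [alt_three_swap_left, alt_three_add_left, alt_three_swap_left a x y,
    alt_three_swap_left a x y']; ring

theorem alt_three_smul_mid (a : V [⋀^Fin 3]→ₗ[ℝ] ℝ) (c : ℝ) (x y z : V) :
    a ![x, c • y, z] = c * a ![x, y, z] := by
  rw [alt_three_swap_left, alt_three_smul_left, alt_three_swap_left a x y]; ring

theorem alt_three_add_right (a : V [⋀^Fin 3]→ₗ[ℝ] ℝ) (x y z z' : V) :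
    a ![x, y, z + z'] = a ![x, y, z] + a ![x, y, z'] := by
  rw [alt_three_swap_right, alt_three_add_mid, alt_three_swap_right a x y z,
    alt_three_swap_right a x y z']; ring

theorem alt_three_smul_right (a : V [⋀^Fin 3]→ₗ[ℝ] ℝ) (c : ℝ) (x y z : V) :
    a ![x, y, c • z] = c * a ![x, y, z] := by
  rw [alt_three_swap_right, alt_three_smul_mid, alt_three_swap_right a x y z]; ring

theorem alt_three_right_self (a : V [⋀^Fin 3]→ₗ[ℝ] ℝ) (x y : V) : a ![x, y, y] = 0 :=
  a.map_eq_zero_of_eq _ (i := 1) (j := 2) rfl (by decide)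

theorem rightContr_two (a : V [⋀^Fin 2]→ₗ[ℝ] ℝ) (β x : V) :
    rightContr β a ![x] = a ![x, β] := by
  change a _ = a _
  congr 1; ext i; fin_cases i <;> rfl

theorem rightContr_three (a : V [⋀^Fin 3]→ₗ[ℝ] ℝ) (β x y : V) :
    rightContr β a ![x, y] = a ![x, y, β] := by
  change a _ = a _
  congr 1; ext i; fin_cases i <;> rfl

theorem rightContr_four (a : V [⋀^Fin 4]→ₗ[ℝ] ℝ) (β : V) (v : Fin 3 → V) :
    rightContr β a v = a ![v 0, v 1, v 2, β] := by
  change a _ = a _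
  congr 1; ext i; fin_cases i <;> rfl

/-- Right contraction is a derivation on a product of two bivectors. -/
theorem rightContr_wedge_two_two (β : V) (a b : V [⋀^Fin 2]→ₗ[ℝ] ℝ) :
    rightContr (k := 3) β (wedge a b : V [⋀^Fin (2 + 2)]→ₗ[ℝ] ℝ) =
      (wedge (rightContr β a) b + wedge (rightContr β b) a : V [⋀^Fin (1 + 2)]→ₗ[ℝ] ℝ) := by
  ext v
  rw [rightContr_four]
  refine (wedge_two_two a b _).trans ?_
  refine Eq.trans ?_ (congrArg₂ (· + ·) (wedge_one_two (rightContr β a) b v)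
    (wedge_one_two (rightContr β b) a v)).symm
  simp only [rightContr_two]
  simp
  ring

end Alternating

/-! ### Smooth functions and their differentials -/

section Differential

variable {n : ℕ} {M : Type*} [TopologicalSpace M] [ChartedSpace (EuclideanSpace ℝ (Fin n)) M]
variable {U : Set M} {F G : M → ℝ} {x : M}

theorem SmoothFunOn.mono {W : Set M} (h : SmoothFunOn n F W) (hU : U ⊆ W) : SmoothFunOn n F U :=
  ContMDiffOn.mono h hU

theorem SmoothFunOn.mul (hF : SmoothFunOn n F U) (hG : SmoothFunOn n G U) :
    SmoothFunOn n (fun y => F y * G y) U :=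
  ContMDiffOn.mul hF hG

theorem SmoothFunOn.sub (hF : SmoothFunOn n F U) (hG : SmoothFunOn n G U) :
    SmoothFunOn n (fun y => F y - G y) U :=
  ContMDiffOn.sub hF hG

theorem SmoothFunOn.neg (hF : SmoothFunOn n F U) : SmoothFunOn n (fun y => -F y) U :=
  ContMDiffOn.neg hF

theorem SmoothFunOn.comp_contDiff {g : ℝ → ℝ} (hg : ContDiff ℝ ∞ g) (hF : SmoothFunOn n F U) :
    SmoothFunOn n (fun y => g (F y)) U :=
  hg.contMDiff.comp_contMDiffOn hF

theorem SmoothFunOn.congr (hF : SmoothFunOn n F U) (h : ∀ y ∈ U, G y = F y) :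
    SmoothFunOn n G U :=
  ContMDiffOn.congr hF h

theorem SmoothFunOn.mdifferentiableAt (hF : SmoothFunOn n F U) (hU : IsOpen U) (hx : x ∈ U) :
    MDifferentiableAt (𝓡 n) 𝓘(ℝ, ℝ) F x :=
  (ContMDiffOn.contMDiffAt hF (hU.mem_nhds hx)).mdifferentiableAt (by simp)

theorem d_congr (hU : IsOpen U) (hx : x ∈ U) (h : ∀ y ∈ U, F y = G y) : d n F x = d n G x :=
  Filter.EventuallyEq.mfderiv_eq (Filter.eventuallyEq_of_mem (hU.mem_nhds hx) h)

theorem d_neg (F : M → ℝ) (x : M) : d n (fun y => -F y) x = -d n F x :=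
  mfderiv_neg (I := 𝓡 n) (E' := ℝ) (f := F) (x := x)

theorem d_add (hF : MDifferentiableAt (𝓡 n) 𝓘(ℝ, ℝ) F x)
    (hG : MDifferentiableAt (𝓡 n) 𝓘(ℝ, ℝ) G x) :
    d n (fun y => F y + G y) x = d n F x + d n G x :=
  mfderiv_add hF hG

theorem d_sub (hF : MDifferentiableAt (𝓡 n) 𝓘(ℝ, ℝ) F x)
    (hG : MDifferentiableAt (𝓡 n) 𝓘(ℝ, ℝ) G x) :
    d n (fun y => F y - G y) x = d n F x - d n G x :=
  mfderiv_sub hF hG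

theorem d_mul (hF : MDifferentiableAt (𝓡 n) 𝓘(ℝ, ℝ) F x)
    (hG : MDifferentiableAt (𝓡 n) 𝓘(ℝ, ℝ) G x) :
    d n (fun y => F y * G y) x = F x • d n G x + G x • d n F x :=
  (hF.hasMFDerivAt.mul hG.hasMFDerivAt).mfderiv

theorem d_exp_neg {s : M → ℝ} (hs : MDifferentiableAt (𝓡 n) 𝓘(ℝ, ℝ) s x) :
    d n (fun y => Real.exp (-s y)) x = -(Real.exp (-s x) • d n s x) := by
  have h := ((Real.hasDerivAt_exp (-s x)).comp (s x)
    (hasDerivAt_neg (s x))).hasFDerivAt.hasMFDerivAt.comp x hs.hasMFDerivAt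
  refine h.mfderiv.trans ?_
  ext v
  let w : ℝ := mfderiv (𝓡 n) 𝓘(ℝ, ℝ) s x v
  change w * (Real.exp (-s x) * -1) = -(Real.exp (-s x) * w)
  ring

end Differential

/-! ### Nambu–Poisson brackets of order three -/

section Nambu

variable {n : ℕ} {M : Type*} [TopologicalSpace M] [ChartedSpace (EuclideanSpace ℝ (Fin n)) M]
variable {U : Set M} {N : MultivectorField n M 3}

theorem bracket_three (N : MultivectorField n M 3) (f g h : M → ℝ) (x : M) :
    bracket N ![f, g, h] x = N x ![d n f x, d n g x, d n h x] := by
  unfold bracket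
  congr 1; ext i : 1; fin_cases i <;> rfl

theorem bracket_swap_left (N : MultivectorField n M 3) (f g h : M → ℝ) :
    bracket N ![g, f, h] = fun x => -bracket N ![f, g, h] x := by
  funext x
  simp only [bracket_three, alt_three_swap_left (N x) (d n f x)]

theorem bracket_swap_right (N : MultivectorField n M 3) (f g h : M → ℝ) :
    bracket N ![f, h, g] = fun x => -bracket N ![f, g, h] x := by
  funext x
  simp only [bracket_three, alt_three_swap_right (N x) (d n f x) (d n g x)]

theorem IsSmoothOn.bracket_three (hN : IsSmoothOn N U) {f g h : M → ℝ} (hf : SmoothFunOn n f U)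
    (hg : SmoothFunOn n g U) (hh : SmoothFunOn n h U) :
    SmoothFunOn n (bracket N ![f, g, h]) U :=
  hN _ (by intro i; fin_cases i <;> assumption)

/-- The fundamental identity of a Nambu–Poisson `3`-vector field, written out. -/
theorem IsNambuPoissonOn.fundamental_three (hN : IsNambuPoissonOn N U) {f h a b c : M → ℝ}
    (hf : SmoothFunOn n f U) (hh : SmoothFunOn n h U) (ha : SmoothFunOn n a U)
    (hb : SmoothFunOn n b U) (hc : SmoothFunOn n c U) {x : M} (hx : x ∈ U) :
    bracket N ![f, h, bracket N ![a, b, c]] x =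
      bracket N ![bracket N ![f, h, a], b, c] x + bracket N ![a, bracket N ![f, h, b], c] x +
        bracket N ![a, b, bracket N ![f, h, c]] x := by
  have snoc_eq : ∀ g : M → ℝ, Fin.snoc (α := fun _ => M → ℝ) ![f, h] g = ![f, h, g] := by
    intro g; ext i : 1; fin_cases i <;> rfl
  have key := hN.fundamental ![f, h] ![a, b, c] (by intro i; fin_cases i <;> assumption)
    (by intro i; fin_cases i <;> assumption) x hx
  simp only [snoc_eq] at key
  have update_eq : ∀ t : M → ℝ, Function.update ![a, b, c] 0 t = ![t, b, c] ∧
      Function.update ![a, b, c] 1 t = ![a, t, c] ∧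
      Function.update ![a, b, c] 2 t = ![a, b, t] := by
    intro t
    refine ⟨?_, ?_, ?_⟩ <;> (ext i : 1; fin_cases i <;> rfl)
  refine (key.trans (Fin.sum_univ_three _)).trans ?_
  rw [(update_eq _).1, (update_eq _).2.1, (update_eq _).2.2]
  rfl

/-- Fixing one entry `h` of a Nambu–Poisson bracket of order three leaves a bracket of two
functions that satisfies the Jacobi identity. -/
theorem IsNambuPoissonOn.jacobi (hN : IsNambuPoissonOn N U) {f₁ f₂ f₃ h : M → ℝ}
    (h₁ : SmoothFunOn n f₁ U) (h₂ : SmoothFunOn n f₂ U) (h₃ : SmoothFunOn n f₃ U)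
    (hh : SmoothFunOn n h U) {x : M} (hx : x ∈ U) :
    bracket N ![bracket N ![f₁, f₂, h], f₃, h] x +
      bracket N ![bracket N ![f₂, f₃, h], f₁, h] x +
      bracket N ![bracket N ![f₃, f₁, h], f₂, h] x = 0 := by
  have key := hN.fundamental_three h₃ hh h₁ h₂ hh hx
  have e0 : bracket N ![f₃, h, h] = fun _ => 0 := by
    funext y; rw [LCNambu.bracket_three, alt_three_right_self]
  rw [bracket_swap_right N f₃ f₁ h, bracket_swap_right N f₃ f₂ h, bracket_swap_left N f₂ f₃ h,
    e0] at key
  simp only [LCNambu.bracket_three N _ _ _ x, neg_neg] at key ⊢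
  have e1 : d n (fun _ : M => (0 : ℝ)) x = 0 := mfderiv_const
  have e2 : d n (fun y => -bracket N ![f₃, f₁, h] y) x =
      (-1 : ℝ) • d n (bracket N ![f₃, f₁, h]) x :=
    (d_neg _ x).trans (neg_one_smul ℝ _).symm
  have e3 : (0 : Cotangent n x) = (0 : ℝ) • 0 := by simp
  have e4 : (fun y => bracket N ![f₂, f₃, h] y) = bracket N ![f₂, f₃, h] := rfl
  rw [e1, e3, e2, e4] at key
  rw [alt_three_smul_left, alt_three_smul_right,
    alt_three_swap_right (N x) (d n f₃ x), alt_three_swap_left _ _ (d n f₃ x),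
    alt_three_swap_left (N x) _ (d n f₁ x)] at key
  linarith

/-- The algebraic content of the fundamental identity, obtained from it by inserting a product
`f g`: the bivectors `ι_{df} N` and `ι_{dg} N` have vanishing exterior product. -/
theorem IsNambuPoissonOn.pluecker (hU : IsOpen U) (hN : IsNambuPoissonOn N U)
    {f g h a b c : M → ℝ}
    (hf : SmoothFunOn n f U) (hg : SmoothFunOn n g U) (hh : SmoothFunOn n h U)
    (ha : SmoothFunOn n a U) (hb : SmoothFunOn n b U) (hc : SmoothFunOn n c U)
    {x : M} (hx : x ∈ U) :
    bracket N ![h, a, f] x * bracket N ![b, c, g] x -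
      bracket N ![h, b, f] x * bracket N ![a, c, g] x +
      bracket N ![h, c, f] x * bracket N ![a, b, g] x +
      bracket N ![a, b, f] x * bracket N ![h, c, g] x -
      bracket N ![a, c, f] x * bracket N ![h, b, g] x +
      bracket N ![b, c, f] x * bracket N ![h, a, g] x = 0 := by
  -- subtracting `f` times the identity for `g` and `g` times that for `f` from the one for `f g`
  -- leaves only terms without derivatives of brackets
  have kf := hN.fundamental_three hf hh ha hb hc hx
  have kg := hN.fundamental_three hg hh ha hb hc hx
  have kfg := hN.fundamental_three (hf.mul hg) hh ha hb hc hx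
  have leibniz : ∀ k : M → ℝ, ∀ y ∈ U, bracket N ![fun y => f y * g y, h, k] y =
      f y * bracket N ![g, h, k] y + g y * bracket N ![f, h, k] y := by
    intro k y hy
    simp only [LCNambu.bracket_three]
    rw [d_mul (hf.mdifferentiableAt hU hy) (hg.mdifferentiableAt hU hy), alt_three_add_left,
      alt_three_smul_left, alt_three_smul_left]
  have d_leibniz : ∀ k : M → ℝ, SmoothFunOn n k U →
      d n (bracket N ![fun y => f y * g y, h, k]) x =
        (f x • d n (bracket N ![g, h, k]) x + bracket N ![g, h, k] x • d n f x) +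
          (g x • d n (bracket N ![f, h, k]) x + bracket N ![f, h, k] x • d n g x) := by
    intro k hk
    have mg := hN.smooth.bracket_three hg hh hk
    have mf := hN.smooth.bracket_three hf hh hk
    rw [d_congr hU hx (leibniz k),
      d_add ((hf.mul mg).mdifferentiableAt hU hx) ((hg.mul mf).mdifferentiableAt hU hx),
      d_mul (hf.mdifferentiableAt hU hx) (mg.mdifferentiableAt hU hx),
      d_mul (hg.mdifferentiableAt hU hx) (mf.mdifferentiableAt hU hx)]
  rw [leibniz _ x hx] at kfg
  simp only [LCNambu.bracket_three N _ _ _ x] at kf kg kfg ⊢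
  rw [d_leibniz a ha, d_leibniz b hb, d_leibniz c hc] at kfg
  simp only [alt_three_add_left, alt_three_add_mid, alt_three_add_right, alt_three_smul_left,
    alt_three_smul_mid, alt_three_smul_right, LCNambu.bracket_three N _ _ _ x] at kfg
  generalize N x = A at *
  generalize d n f x = f' at *
  generalize d n g x = g' at *
  generalize d n h x = h' at *
  generalize d n a x = a' at *
  generalize d n b x = b' at *
  generalize d n c x = c' at *
  -- move `f'` and `g'` to the last slot
  have rot : ∀ u v w : Cotangent n x, A ![u, v, w] = A ![v, w, u] := fun u v w => by
    rw [alt_three_swap_left, alt_three_swap_right, neg_neg]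
  rw [rot f' h' a', rot f' h' b', rot f' h' c', rot g' h' a', rot g' h' b', rot g' h' c',
    rot f' b' c', rot g' b' c', alt_three_swap_right A a' c' f', alt_three_swap_right A a' c' g']
    at kfg
  linear_combination f x * kg + g x * kf - kfg

end Nambu

/-! ### Conformal change of Nambu–Poisson fields -/

section Conformal

variable {n : ℕ} {M : Type*} [TopologicalSpace M] [ChartedSpace (EuclideanSpace ℝ (Fin n)) M]
variable {U : Set M} {N η : MultivectorField n M 3} {θ : OneForm n M} {s : M → ℝ}

/-- `η` and `θ` are described on the open set `U` by a Nambu–Poisson field `N` and a conformal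
factor `s`: there `η = exp(-2s) N` and `θ = ds`. -/
structure IsConformalFrame (N : MultivectorField n M 3) (s : M → ℝ) (U : Set M)
    (η : MultivectorField n M 3) (θ : OneForm n M) : Prop where
  isOpen : IsOpen U
  nambuPoisson : IsNambuPoissonOn N U
  smooth : SmoothFunOn n s U
  field_eq : ∀ x ∈ U, η x = Real.exp (-(2 * s x)) • N x
  form_eq : ∀ x ∈ U, θ x = d n s x

/-- The function `exp(-s) F`, in terms of which the conformally changed brackets become the
original ones. -/
noncomputable def rescale (s F : M → ℝ) : M → ℝ := fun y => Real.exp (-s y) * F y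

theorem SmoothFunOn.exp_neg (hs : SmoothFunOn n s U) :
    SmoothFunOn n (fun y => Real.exp (-s y)) U :=
  hs.neg.comp_contDiff Real.contDiff_exp

theorem SmoothFunOn.rescale {F : M → ℝ} (hs : SmoothFunOn n s U) (hF : SmoothFunOn n F U) :
    SmoothFunOn n (rescale s F) U :=
  hs.exp_neg.mul hF

theorem d_rescale {F : M → ℝ} (hU : IsOpen U) (hs : SmoothFunOn n s U) (hF : SmoothFunOn n F U)
    {x : M} (hx : x ∈ U) :
    d n (rescale s F) x = Real.exp (-s x) • (d n F x + (-F x) • d n s x) := by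
  unfold LCNambu.rescale
  rw [d_mul (hs.exp_neg.mdifferentiableAt hU hx) (hF.mdifferentiableAt hU hx),
    d_exp_neg (hs.mdifferentiableAt hU hx)]
  module

theorem Lam2_apply (η : MultivectorField n M 3) (θ : OneForm n M) (H : M → ℝ) (x : M)
    (α β : Cotangent n x) :
    Lam2 η θ H x ![α, β] = η x ![α, β, d n H x] - H x * η x ![α, β, θ x] := by
  change rightContr (d n H x) (η x) ![α, β] + H x * -(rightContr (θ x) (η x) ![α, β]) = _
  rw [rightContr_three, rightContr_three]
  ring

theorem Zed2_apply (η : MultivectorField n M 3) (θ : OneForm n M) (H : M → ℝ) (x : M)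
    (α : Cotangent n x) : Zed2 η θ H x ![α] = -η x ![α, d n H x, θ x] := by
  change rightContr (d n H x) (assocE η θ x) ![α] = _
  rw [rightContr_two]
  change -(rightContr (θ x) (η x) ![α, d n H x]) = _
  rw [rightContr_three]

/-- The first Jacobi pair is the second one for `-H`, so that only one family of pairs, linear in
`H`, has to be treated. -/
theorem Lam1_eq_Lam2_neg (η : MultivectorField n M 3) (θ : OneForm n M) (H : M → ℝ) :
    Lam1 η θ H = Lam2 η θ (fun y => -H y) := by
  funext x
  have e2 : ∀ f : Fin 2 → Cotangent n x, f = ![f 0, f 1] :=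
    fun f => by ext i : 1; fin_cases i <;> rfl
  ext v
  rw [e2 v, Lam2_apply, d_neg]
  change -(rightContr (d n H x) (η x) ![v 0, v 1]) -
    H x * -(rightContr (θ x) (η x) ![v 0, v 1]) = _
  rw [rightContr_three, rightContr_three, ← neg_one_smul ℝ (d n H x), alt_three_smul_right]
  ring

theorem Zed1_eq_Zed2_neg (η : MultivectorField n M 3) (θ : OneForm n M) (H : M → ℝ) :
    Zed1 η θ H = Zed2 η θ (fun y => -H y) := by
  funext x
  have e1 : ∀ f : Fin 1 → Cotangent n x, f = ![f 0] :=
    fun f => by ext i : 1; fin_cases i; rfl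
  ext v
  rw [e1 v, Zed2_apply, d_neg, ← neg_one_smul ℝ (d n H x), alt_three_smul_mid]
  change -(Zed2 η θ H x ![v 0]) = _
  rw [Zed2_apply]
  ring

theorem Lam2_sub {H K : M → ℝ} (hH : SmoothFunOn n H Set.univ) (hK : SmoothFunOn n K Set.univ)
    (η : MultivectorField n M 3) (θ : OneForm n M) (x : M) :
    Lam2 η θ (fun y => H y - K y) x = Lam1 η θ K x + Lam2 η θ H x := by
  have e2 : ∀ f : Fin 2 → Cotangent n x, f = ![f 0, f 1] :=
    fun f => by ext i : 1; fin_cases i <;> rfl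
  ext v
  rw [Lam1_eq_Lam2_neg, e2 v, AlternatingMap.add_apply, Lam2_apply, Lam2_apply, Lam2_apply, d_neg,
    d_sub (hH.mdifferentiableAt isOpen_univ trivial) (hK.mdifferentiableAt isOpen_univ trivial),
    sub_eq_add_neg (d n H x), ← neg_one_smul ℝ (d n K x), alt_three_add_right, alt_three_smul_right]
  ring

theorem Zed2_sub {H K : M → ℝ} (hH : SmoothFunOn n H Set.univ) (hK : SmoothFunOn n K Set.univ)
    (η : MultivectorField n M 3) (θ : OneForm n M) (x : M) :
    Zed2 η θ (fun y => H y - K y) x = Zed1 η θ K x + Zed2 η θ H x := by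
  have e1 : ∀ f : Fin 1 → Cotangent n x, f = ![f 0] :=
    fun f => by ext i : 1; fin_cases i; rfl
  ext v
  rw [Zed1_eq_Zed2_neg, e1 v, AlternatingMap.add_apply, Zed2_apply, Zed2_apply, Zed2_apply, d_neg,
    d_sub (hH.mdifferentiableAt isOpen_univ trivial) (hK.mdifferentiableAt isOpen_univ trivial),
    sub_eq_add_neg (d n H x), ← neg_one_smul ℝ (d n K x), alt_three_add_mid, alt_three_smul_mid]
  ring

namespace IsConformalFrame

variable {F G H : M → ℝ}

/-- On exact forms, `Λ²` is `exp(-s)` times the Poisson bivector `ι_{d(exp(-s)H)} N`. -/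
theorem Lam2_d (h : IsConformalFrame N s U η θ) (hH : SmoothFunOn n H U) {x : M} (hx : x ∈ U) :
    Lam2 η θ H x ![d n F x, d n G x] = Real.exp (-s x) * bracket N ![F, G, rescale s H] x := by
  rw [Lam2_apply, h.field_eq x hx, h.form_eq x hx, bracket_three,
    d_rescale h.isOpen h.smooth hH hx, alt_three_smul_right, alt_three_add_right,
    alt_three_smul_right, AlternatingMap.smul_apply, AlternatingMap.smul_apply, smul_eq_mul,
    smul_eq_mul, show -(2 * s x) = -s x + -s x by ring, Real.exp_add]
  ring

/-- Conjugation with `exp(s)` turns the Jacobi bracket of `(Λ², Z²)` into the bracket of the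
Poisson bivector `ι_{d(exp(-s)H)} N`. -/
theorem jacobiBracket_eq (h : IsConformalFrame N s U η θ) (hF : SmoothFunOn n F U)
    (hG : SmoothFunOn n G U) (hH : SmoothFunOn n H U) {x : M} (hx : x ∈ U) :
    jacobiBracket (Lam2 η θ H) (Zed2 η θ H) F G x =
      Real.exp (s x) * bracket N ![rescale s F, rescale s G, rescale s H] x := by
  unfold jacobiBracket
  rw [h.Lam2_d hH hx, Zed2_apply, Zed2_apply, bracket_three, bracket_three,
    d_rescale h.isOpen h.smooth hH hx, d_rescale h.isOpen h.smooth hF hx,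
    d_rescale h.isOpen h.smooth hG hx, h.field_eq x hx, h.form_eq x hx]
  simp only [alt_three_add_left, alt_three_add_mid, alt_three_add_right, alt_three_smul_left,
    alt_three_smul_mid, alt_three_smul_right, AlternatingMap.smul_apply, smul_eq_mul,
    alt_three_right_self]
  -- the three rescalings produce `exp(-3s)`, one factor of which cancels against `exp(s)`
  have e : Real.exp (s x) * Real.exp (-s x) = 1 := by rw [← Real.exp_add]; simp
  have e' : Real.exp (-(2 * s x)) = Real.exp (-s x) * Real.exp (-s x) := by
    rw [← Real.exp_add]; ring_nf
  rw [e']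
  generalize N x = A
  generalize d n F x = f'
  generalize d n G x = g'
  generalize d n H x = h'
  generalize d n s x = t
  have rot : ∀ u v w : Cotangent n x, A ![u, v, w] = A ![v, w, u] := fun u v w => by
    rw [alt_three_swap_left, alt_three_swap_right, neg_neg]
  rw [rot t g' h', rot t t h', rot t h' t, rot t g' t, alt_three_swap_right A f' h' t]
  simp only [alt_three_right_self]
  linear_combination (-(Real.exp (-s x) ^ 2 * (A ![f', g', h'] - H x * A ![f', g', t] +
    G x * A ![f', h', t] - F x * A ![g', h', t]))) * e

theorem smooth_jacobiBracket (h : IsConformalFrame N s U η θ) (hF : SmoothFunOn n F U)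
    (hG : SmoothFunOn n G U) (hH : SmoothFunOn n H U) :
    SmoothFunOn n (jacobiBracket (Lam2 η θ H) (Zed2 η θ H) F G) U :=
  ((h.smooth.comp_contDiff Real.contDiff_exp).mul
    (h.nambuPoisson.smooth.bracket_three (h.smooth.rescale hF) (h.smooth.rescale hG)
      (h.smooth.rescale hH))).congr fun _ hx => h.jacobiBracket_eq hF hG hH hx

/-- Iterated Jacobi brackets are conjugate to iterated Poisson brackets. -/
theorem jacobiBracket_jacobiBracket (h : IsConformalFrame N s U η θ) {K : M → ℝ}
    (hF : SmoothFunOn n F U) (hG : SmoothFunOn n G U) (hK : SmoothFunOn n K U)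
    (hH : SmoothFunOn n H U) {x : M} (hx : x ∈ U) :
    jacobiBracket (Lam2 η θ H) (Zed2 η θ H) (jacobiBracket (Lam2 η θ H) (Zed2 η θ H) F G) K x =
      Real.exp (s x) * bracket N ![bracket N ![rescale s F, rescale s G, rescale s H],
        rescale s K, rescale s H] x := by
  rw [h.jacobiBracket_eq (h.smooth_jacobiBracket hF hG hH) hK hH hx, bracket_three N _ _ _ x,
    bracket_three N _ _ _ x]
  rw [d_congr h.isOpen hx (G := bracket N ![rescale s F, rescale s G, rescale s H])]
  intro y hy
  rw [LCNambu.rescale, h.jacobiBracket_eq hF hG hH hy, ← mul_assoc, ← Real.exp_add]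
  simp

theorem jacobi (h : IsConformalFrame N s U η θ) {K : M → ℝ}
    (hF : SmoothFunOn n F U) (hG : SmoothFunOn n G U) (hK : SmoothFunOn n K U)
    (hH : SmoothFunOn n H U) {x : M} (hx : x ∈ U) :
    jacobiBracket (Lam2 η θ H) (Zed2 η θ H) (jacobiBracket (Lam2 η θ H) (Zed2 η θ H) F G) K x +
      jacobiBracket (Lam2 η θ H) (Zed2 η θ H) (jacobiBracket (Lam2 η θ H) (Zed2 η θ H) G K) F x +
      jacobiBracket (Lam2 η θ H) (Zed2 η θ H) (jacobiBracket (Lam2 η θ H) (Zed2 η θ H) K F) G x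
      = 0 := by
  rw [h.jacobiBracket_jacobiBracket hF hG hK hH hx, h.jacobiBracket_jacobiBracket hG hK hF hH hx,
    h.jacobiBracket_jacobiBracket hK hF hG hH hx, ← mul_add, ← mul_add,
    h.nambuPoisson.jacobi (h.smooth.rescale hF) (h.smooth.rescale hG) (h.smooth.rescale hK)
      (h.smooth.rescale hH) hx, mul_zero]

theorem smooth_Lam2 (h : IsConformalFrame N s U η θ) (hH : SmoothFunOn n H U) :
    IsSmoothOn (Lam2 η θ H) U := by
  intro F hF
  refine (h.smooth.exp_neg.mul
    (h.nambuPoisson.smooth.bracket_three (hF 0) (hF 1) (h.smooth.rescale hH))).congr fun x hx => ?_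
  rw [← h.Lam2_d hH hx]
  unfold bracket
  congr 1; ext i : 1; fin_cases i <;> rfl

theorem smooth_Zed2 (h : IsConformalFrame N s U η θ) (hH : SmoothFunOn n H U) :
    IsSmoothOn (Zed2 η θ H) U := by
  intro F hF
  refine ((h.smooth.exp_neg.mul h.smooth.exp_neg).mul
    (h.nambuPoisson.smooth.bracket_three (hF 0) hH h.smooth)).neg.congr fun x hx => ?_
  have e1 : (fun i => d n (F i) x) = ![d n (F 0) x] := by ext i : 1; fin_cases i; rfl
  rw [bracket, e1, Zed2_apply, h.field_eq x hx, h.form_eq x hx, bracket_three, ← Real.exp_add,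
    AlternatingMap.smul_apply, smul_eq_mul]
  ring_nf

/-- The `4`-vector field `Λ¹ ∧ Λ²` annihilates all tuples of exact forms: up to a factor, `Λ¹` and
`Λ²` are contractions of the same Nambu–Poisson tensor, so `pluecker` applies. -/
theorem eta4_bracket_eq_zero (h : IsConformalFrame N s U η θ) {K : M → ℝ}
    (hH : SmoothFunOn n H U) (hK : SmoothFunOn n K U) {F : Fin 4 → M → ℝ}
    (hF : ∀ i, SmoothFunOn n (F i) U) {x : M} (hx : x ∈ U) :
    bracket (eta4 η θ H K) F x = 0 := by
  refine (wedge_two_two (Lam1 η θ H x) (Lam2 η θ K x) _).trans ?_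
  rw [Lam1_eq_Lam2_neg]
  simp only [h.Lam2_d hH.neg hx, h.Lam2_d hK hx]
  have key := h.nambuPoisson.pluecker h.isOpen (h.smooth.rescale hH.neg) (h.smooth.rescale hK)
    (hF 0) (hF 1) (hF 2) (hF 3) hx
  linear_combination (Real.exp (-s x)) ^ 2 * key

end IsConformalFrame

theorem IsLCNambuPoisson.isConformalFrame {ι : Type*} {U : ι → Set M} {σ : ι → M → ℝ}
    {ηloc : ι → MultivectorField n M 3} (h : IsLCNambuPoisson U σ ηloc) (hθ : IsLeeForm U σ θ)
    (hη : IsGluing U σ ηloc η) (a : ι) : IsConformalFrame (ηloc a) (σ a) (U a) η θ where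
  isOpen := h.isOpen a
  nambuPoisson := h.nambuPoisson a
  smooth := h.smooth a
  field_eq x hx := by simpa using hη a x hx
  form_eq := hθ a

theorem smoothFunOn_univ_of_cover {ι : Type*} {U : ι → Set M} (hU : ∀ a, IsOpen (U a))
    (hcov : ∀ x, ∃ a, x ∈ U a) {F : M → ℝ} (hF : ∀ a, SmoothFunOn n F (U a)) :
    SmoothFunOn n F Set.univ := by
  intro x _
  obtain ⟨a, ha⟩ := hcov x
  exact (ContMDiffOn.contMDiffAt (hF a) ((hU a).mem_nhds ha)).contMDiffWithinAt

theorem IsLCNambuPoisson.isJacobiPair {ι : Type*} {U : ι → Set M} {σ : ι → M → ℝ}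
    {ηloc : ι → MultivectorField n M 3} (h : IsLCNambuPoisson U σ ηloc) (hθ : IsLeeForm U σ θ)
    (hη : IsGluing U σ ηloc η) {H : M → ℝ} (hH : SmoothFunOn n H Set.univ) :
    IsJacobiPair (Lam2 η θ H) (Zed2 η θ H) where
  smooth_bivector F hF := smoothFunOn_univ_of_cover h.isOpen h.cover fun a =>
    (h.isConformalFrame hθ hη a).smooth_Lam2 (hH.mono (Set.subset_univ _)) F
      fun i => (hF i).mono (Set.subset_univ _)
  smooth_vector F hF := smoothFunOn_univ_of_cover h.isOpen h.cover fun a =>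
    (h.isConformalFrame hθ hη a).smooth_Zed2 (hH.mono (Set.subset_univ _)) F
      fun i => (hF i).mono (Set.subset_univ _)
  jacobi F₁ F₂ F₃ h₁ h₂ h₃ x := by
    obtain ⟨a, ha⟩ := h.cover x
    exact (h.isConformalFrame hθ hη a).jacobi (h₁.mono (Set.subset_univ _))
      (h₂.mono (Set.subset_univ _)) (h₃.mono (Set.subset_univ _)) (hH.mono (Set.subset_univ _)) ha

/-- A `(q+1)`-vector field of even order that annihilates all tuples of exact forms on an open
set is generalized Poisson there. -/
theorem isGenPoissonOn_of_bracket_eq_zero {q : ℕ} (hq : Even (q + 1))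
    {ζ : MultivectorField n M (q + 1)}
    (hζ : ∀ F : Fin (q + 1) → M → ℝ, (∀ i, SmoothFunOn n (F i) U) → ∀ x ∈ U, bracket ζ F x = 0) :
    IsGenPoissonOn ζ U where
  even_order := hq
  smooth F hF := (contMDiffOn_const (c := (0 : ℝ))).congr (hζ F hF)
  jacobi F hF x hx := by
    refine Finset.sum_eq_zero fun τ _ => ?_
    rw [hζ _ _ x hx, mul_zero]
    intro i
    refine Fin.lastCases ?_ (fun j => ?_) i
    · rw [Fin.snoc_last]
      exact (contMDiffOn_const (c := (0 : ℝ))).congr (hζ _ fun j => hF _)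
    · rw [Fin.snoc_castSucc]
      exact hF _

/-- This is the derivation property of `ι_θ`, since `ι_θ Λⁱ = Zⁱ`. -/
theorem E3_eq_contr_eta4 (η : MultivectorField n M 3) (θ : OneForm n M) (H K : M → ℝ) :
    E3 η θ H K = contr θ (eta4 η θ H K) := by
  funext x
  have e1 : ∀ f : Fin 1 → Cotangent n x, f = ![f 0] :=
    fun f => by ext i : 1; fin_cases i; rfl
  have key : ∀ L : M → ℝ, rightContr (θ x) (Lam2 η θ L x) = Zed2 η θ L x := by
    intro L
    ext v
    rw [e1 v, rightContr_two, Lam2_apply, Zed2_apply, alt_three_right_self,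
      alt_three_swap_right (η x) (v 0) (d n L x)]
    ring
  have hc := rightContr_wedge_two_two (θ x) (Lam1 η θ H x) (Lam2 η θ K x)
  rw [key, Lam1_eq_Lam2_neg, key, ← Lam1_eq_Lam2_neg, ← Zed1_eq_Zed2_neg] at hc
  exact hc.symm

end Conformal
end LCNambu

open LCNambu in
theorem mainTheorem8 {n : ℕ} {M : Type*} [TopologicalSpace M] [T2Space M]
    [ChartedSpace (EuclideanSpace ℝ (Fin n)) M] [IsManifold (𝓡 n) ∞ M]
    {ι : Type*} (U : ι → Set M) (σ : ι → M → ℝ) (ηloc : ι → MultivectorField n M 3)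
    (hLC : IsLCNambuPoisson U σ ηloc)
    (θ : OneForm n M) (hθ : IsLeeForm U σ θ)
    (η : MultivectorField n M 3) (hη : IsGluing U σ ηloc η)
    (H₁ H₂ : M → ℝ) (hH₁ : SmoothFunOn n H₁ Set.univ) (hH₂ : SmoothFunOn n H₂ Set.univ) :
    AreCompatibleJacobiPairs (Lam1 η θ H₁) (Zed1 η θ H₁) (Lam2 η θ H₂) (Zed2 η θ H₂) ∧
    E3 η θ H₁ H₂ = contr θ (eta4 η θ H₁ H₂) ∧
    IsLCGenPoisson U σ (fun a x => Real.exp (3 * σ a x) • eta4 η θ H₁ H₂ x) ∧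
    IsGluing U σ (fun a x => Real.exp (3 * σ a x) • eta4 η θ H₁ H₂ x) (eta4 η θ H₁ H₂) ∧
    IsLCGenPoissonTriple (eta4 η θ H₁ H₂) θ := by
  have glue : IsGluing U σ (fun a x => Real.exp (3 * σ a x) • eta4 η θ H₁ H₂ x)
      (eta4 η θ H₁ H₂) := by
    intro a x _
    rw [smul_smul, ← Real.exp_add]
    simp
  have lc : IsLCGenPoisson U σ (fun a x => Real.exp (3 * σ a x) • eta4 η θ H₁ H₂ x) :=
    { isOpen := hLC.isOpen
      cover := hLC.cover
      smooth := hLC.smooth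
      d_agree := hLC.d_agree
      conformal := fun a b x hx => (glue a x hx.1).symm.trans (glue b x hx.2)
      genPoisson := fun a => isGenPoissonOn_of_bracket_eq_zero (by decide)
        fun F hF x hx => by
          have h0 := (hLC.isConformalFrame hθ hη a).eta4_bracket_eq_zero
            (hH₁.mono (Set.subset_univ _)) (hH₂.mono (Set.subset_univ _)) hF hx
          exact (congrArg (Real.exp (3 * σ a x) * ·) h0).trans (mul_zero _) }
  refine ⟨⟨?_, hLC.isJacobiPair hθ hη hH₂, ?_⟩, E3_eq_contr_eta4 η θ H₁ H₂, lc, glue, ?_⟩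
  · rw [Lam1_eq_Lam2_neg, Zed1_eq_Zed2_neg]
    exact hLC.isJacobiPair hθ hη hH₁.neg
  · have h := hLC.isJacobiPair hθ hη (hH₂.sub hH₁)
    rwa [funext (Lam2_sub hH₂ hH₁ η θ), funext (Zed2_sub hH₂ hH₁ η θ)] at h
  · -- the index type must live in the universe of `M`: index the cover by the points of `M`
    choose c hc using hLC.cover
    exact ⟨M, fun x => U (c x), fun x => σ (c x), _,
      { isOpen := fun x => lc.isOpen (c x)
        cover := fun x => ⟨x, hc x⟩
        smooth := fun x => lc.smooth (c x)
        d_agree := fun x y => lc.d_agree (c x) (c y)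
        conformal := fun x y => lc.conformal (c x) (c y)
        genPoisson := fun x => lc.genPoisson (c x) },
      fun x => hθ (c x), fun x => glue (c x)⟩
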